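/- Let $T, W \ge 1$ be integers with $T \ge 2$ unless $W = 1$. Consider the absorbing Markov chain whose transient states are $s_t^i$ ($1 \le t \le T$, $1 \le i \le W$; layer $t$ is $\{s_t^1, \dots, s_t^W\}$) and whose absorbing states are $0$ and $1$: from any state of a layer $t < T$ the chain moves to each state of layer $t+1$ with probability $1/W$, and from any state of layer $T$ it moves to each of the two absorbing states with probability $1/2$. Let $p^\star_{mk}$ be the probability of being absorbed in $k$ when starting from $m$. Let $(\boldsymbol{s}^n, y^n)$, $n = 1, \dots, N$, be independent trajectories of this chain, where the first state is uniform on layer $1$, $\boldsymbol{s}^n = (s^n_1, \dots, s^n_T)$ is the sequence of transient states and $y^n \in \{0,1\}$ is the absorbing state reached. Occurrences below are counted with multiplicity. The direct (DCE) estimator $\hat p^{\mathrm{dir}}_{mk}$ is the fraction of the occurrences of $m$ in the data that lie in trajectories with $y^n = k$. For the indirect (TC) estimator, let $\hat q_{mm'}$ and $\hat r_{mk}$ be the fractions of the observed one-step transitions out of $m$ that go to the transient state $m'$ and to the absorbing state $k$, respectively; then $\hat{\boldsymbol P}^{\mathrm{ind}} = \lim_{i \to \infty} \boldsymbol P_i$,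 where $\boldsymbol P_{i+1} = \hat{\boldsymbol Q} \boldsymbol P_i + \hat{\boldsymbol R}$ and $\boldsymbol P_0$ is an arbitrary fixed row-stochastic matrix. For states that do not occur in the data, the row of $\hat{\boldsymbol P}^{\mathrm{dir}}$ is that of an arbitrary fixed row-stochastic matrix, and the iteration leaves the row of $\boldsymbol P_i$ unchanged. Then, for every state $m$ in the first layer and every $k \in \{0, 1\}$, $$\frac{\mathbf{E}\bigl[(\hat p^{\mathrm{ind}}_{mk} - p^\star_{mk})^2\bigr]}{\mathbf{E}\bigl[(\hat p^{\mathrm{dir}}_{mk} - p^\star_{mk})^2\bigr]} \longrightarrow \frac1W \qquad (N \to \infty).$$ -/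

import Mathlib

open Filter Topology MeasureTheory ProbabilityTheory

/-- Nonnegative entries, every row summing to one. -/
def IsRowStochastic {S K : Type*} [Fintype K] (P : Matrix S K ℝ) : Prop :=
  (∀ m k, 0 ≤ P m k) ∧ ∀ m, ∑ k, P m k = 1

/-- A trajectory through `L` transient states, followed by the class (absorbing state) it ends in. -/
abbrev Trajectory (L : ℕ) (S K : Type*) := (Fin L → S) × K

noncomputable section

/-- Absorption probabilities of the chain with transient-to-transient transition matrix `Q` and
transient-to-absorbing transition matrix `R`: starting in `m`, the chain enters the absorbing state
`k` at step `t + 1` with probability `(Q ^ t * R) m k`. -/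
def absorptionProb {S K : Type*} [Fintype S] [DecidableEq S]
    (Q : Matrix S S ℝ) (R : Matrix S K ℝ) : Matrix S K ℝ :=
  fun m k => ∑' t : ℕ, (Q ^ t * R) m k

/-- Probability that the chain `(Q, R)` with initial distribution `ν` follows exactly the
trajectory `τ`. -/
def trajectoryProb {L : ℕ} [NeZero L] {S K : Type*}
    (ν : S → ℝ) (Q : Matrix S S ℝ) (R : Matrix S K ℝ) (τ : Trajectory L S K) : ℝ :=
  ν (τ.1 0) * ∏ t : Fin L,
    if h : t.val + 1 < L then Q (τ.1 t) (τ.1 ⟨t.val + 1, h⟩) else R (τ.1 t) τ.2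

/-! ### Estimators

A dataset is a family of `N` trajectories. All counts are with multiplicity: they range over the
pairs `(n, t)` of a trajectory and a position in it. -/

section Estimators

variable {N L : ℕ} {S K : Type*} [DecidableEq S] [DecidableEq K]

/-- Number of occurrences of the transient state `m`. -/
def visitCount (D : Fin N → Trajectory L S K) (m : S) : ℕ :=
  (Finset.univ.filter fun p : Fin N × Fin L => (D p.1).1 p.2 = m).card

/-- Number of occurrences of `m` in trajectories that end in class `k`. -/
def outcomeCount (D : Fin N → Trajectory L S K) (m : S) (k : K) : ℕ :=
  (Finset.univ.filter fun p : Fin N × Fin L => (D p.1).1 p.2 = m ∧ (D p.1).2 = k).card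

/-- Number of one-step transitions from `m` to the transient state `m'`. -/
def transitionCount (D : Fin N → Trajectory L S K) (m m' : S) : ℕ :=
  (Finset.univ.filter fun p : Fin N × Fin L =>
    (D p.1).1 p.2 = m ∧ ∃ h : p.2.val + 1 < L, (D p.1).1 ⟨p.2.val + 1, h⟩ = m').card

/-- Number of one-step transitions from `m` to the absorbing state `k`. -/
def absorptionCount (D : Fin N → Trajectory L S K) (m : S) (k : K) : ℕ :=
  (Finset.univ.filter fun p : Fin N × Fin L =>
    (D p.1).1 p.2 = m ∧ p.2.val + 1 = L ∧ (D p.1).2 = k).card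

/-- Direct estimator: the fraction of the occurrences of `m` that end in class `k`. The data say
nothing about a state that does not occur; its row is taken from `P₀`. -/
def directEstimate (P₀ : Matrix S K ℝ) (D : Fin N → Trajectory L S K) : Matrix S K ℝ :=
  fun m k => if visitCount D m = 0 then P₀ m k
    else (outcomeCount D m k : ℝ) / (visitCount D m : ℝ)

/-- Empirical transition probabilities between transient states. The row of a state that does not
occur is the identity row, so that the fixed-point iteration leaves that state's estimate at its
initial value. -/
def empiricalQ (D : Fin N → Trajectory L S K) : Matrix S S ℝ :=
  fun m m' => if visitCount D m = 0 then (if m = m' then 1 else 0)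
    else (transitionCount D m m' : ℝ) / (visitCount D m : ℝ)

/-- Empirical transition probabilities into the absorbing states. -/
def empiricalR (D : Fin N → Trajectory L S K) : Matrix S K ℝ :=
  fun m k => if visitCount D m = 0 then 0
    else (absorptionCount D m k : ℝ) / (visitCount D m : ℝ)

/-- Indirect estimator: the limit of the iteration `P ↦ Q̂ P + R̂` on the empirical chain, started
from `P₀`. -/
def indirectEstimate [Fintype S] (P₀ : Matrix S K ℝ) (D : Fin N → Trajectory L S K) :
    Matrix S K ℝ :=
  fun m k => limUnder atTop fun i : ℕ =>
    ((fun P : Matrix S K ℝ => empiricalQ D * P + empiricalR D)^[i] P₀) m k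

end Estimators

/-! ### The layered chain

The transient state `(t, i)` is the `i`-th state of layer `t`, layers being numbered from `0`. -/

section Layered

variable (T W : ℕ)

/-- The uniform distribution on the first layer. -/
def layeredInit : Fin T × Fin W → ℝ :=
  fun s => if s.1.val = 0 then 1 / (W : ℝ) else 0

/-- Uniform transitions from each layer to the next one. -/
def layeredQ : Matrix (Fin T × Fin W) (Fin T × Fin W) ℝ :=
  fun s s' => if s'.1.val = s.1.val + 1 then 1 / (W : ℝ) else 0

/-- From the last layer, each of the two absorbing states is entered with probability `1/2`. -/
def layeredR : Matrix (Fin T × Fin W) (Fin 2) ℝ :=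
  fun s _ => if s.1.val + 1 = T then 1 / 2 else 0

end Layered

end

/-!
Exchanging the two classes of a single trajectory preserves its law. Hence, given the sequences of
transient states, the classes are independent fair coins, and an estimator whose error averages the
centered classes in each stratum of the data and weights these averages by `w` has mean squared
error `1 / 4` times the expectation of the sum of `w s ^ 2 / n s` over the strata `s`, where `n s`
is the number of trajectories in `s`. A stratum here is the set of trajectories through one given
state of a layer, so `n s` is about `N / W`. The direct estimator puts weight `1` on the single
stratum of `m`, which gives `W / (4 * N)`. The indirect estimator spreads its weight over the `W`
states of the last layer, nearly evenly, which gives `1 / (4 * N)`.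
-/

section AffineIteration

variable {S K : Type*} [Fintype S] {Q : Matrix S S ℝ} {R P : Matrix S K ℝ}

/-- One step of the fixed-point iteration for the absorption probabilities of the chain `(Q, R)`;
`indirectEstimate` is the limit of its iterates for the empirical chain. -/
def absorptionStep (Q : Matrix S S ℝ) (R P : Matrix S K ℝ) : Matrix S K ℝ := Q * P + R

lemma absorptionStep_apply (Q : Matrix S S ℝ) (R P : Matrix S K ℝ) (s : S) (k : K) :
    absorptionStep Q R P s k = ∑ x, Q s x * P x k + R s k := by
  rw [absorptionStep, Matrix.add_apply, Matrix.mul_apply]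

lemma absorptionStep_iterate [DecidableEq S] (Q : Matrix S S ℝ) (R P : Matrix S K ℝ) (i : ℕ) :
    (absorptionStep Q R)^[i] P = Q ^ i * P + ∑ j ∈ Finset.range i, Q ^ j * R := by
  induction i with
  | zero => simp
  | succ i ih =>
    rw [Function.iterate_succ_apply', ih, absorptionStep, Matrix.mul_add, Finset.sum_range_succ',
      Matrix.mul_sum, pow_zero, Matrix.one_mul, ← add_assoc]
    simp only [pow_succ', Matrix.mul_assoc]

lemma absorptionStep_iterate_mem_Icc {k : K} (hQ : ∀ s x, 0 ≤ Q s x) (hR : ∀ s, 0 ≤ R s k)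
    (hsum : ∀ s, ∑ x, Q s x + R s k ≤ 1) (hP : ∀ s, P s k ∈ Set.Icc (0 : ℝ) 1) (i : ℕ) (s : S) :
    ((absorptionStep Q R)^[i] P) s k ∈ Set.Icc (0 : ℝ) 1 := by
  induction i generalizing s with
  | zero => exact hP s
  | succ i ih =>
    rw [Function.iterate_succ_apply', absorptionStep_apply]
    refine ⟨add_nonneg (Finset.sum_nonneg fun x _ => mul_nonneg (hQ s x) (ih x).1) (hR s), ?_⟩
    refine le_trans ?_ (hsum s)
    gcongr with x
    exact mul_le_of_le_one_right (hQ s x) (ih x).2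

lemma pow_apply_mem_Icc [DecidableEq S] (hQ : ∀ s x, 0 ≤ Q s x) (hsum : ∀ s, ∑ x, Q s x ≤ 1)
    (j : ℕ) (s x : S) : (Q ^ j) s x ∈ Set.Icc (0 : ℝ) 1 := by
  have hone : ∀ s, (1 : Matrix S S ℝ) s x ∈ Set.Icc (0 : ℝ) 1 := fun s => by
    rw [Matrix.one_apply]
    split_ifs <;> simp
  simpa [absorptionStep_iterate] using
    absorptionStep_iterate_mem_Icc (R := 0) hQ (fun _ => le_rfl) (by simpa using hsum) hone j s

/-- A state that leads only to the next layer becomes stationary one step after that layer. -/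
lemma absorptionStep_iterate_succ_apply {L : ℕ} {ℓ : S → Fin L}
    (hQ : ∀ s, (∀ P, absorptionStep Q R P s = P s) ∨
      ∀ x, (ℓ x : ℕ) ≠ ℓ s + 1 → Q s x = 0)
    (i : ℕ) {s : S} (hs : L ≤ i + ℓ s) (k : K) :
    ((absorptionStep Q R)^[i + 1] P) s k = ((absorptionStep Q R)^[i] P) s k := by
  induction i generalizing s with
  | zero => omega
  | succ i ih =>
    rw [Function.iterate_succ_apply']
    rcases hQ s with hfrozen | hadvance
    · rw [hfrozen]
    · rw [Function.iterate_succ_apply' _ i, absorptionStep_apply, absorptionStep_apply]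
      congr 1
      refine Finset.sum_congr rfl fun x _ => ?_
      by_cases hx : (ℓ x : ℕ) = ℓ s + 1
      · rw [← Function.iterate_succ_apply' (absorptionStep Q R), ih (by omega)]
      · rw [hadvance x hx, zero_mul, zero_mul]

end AffineIteration

section LayeredChain

variable {S K : Type*} [Fintype S] {L : ℕ}

/-- The chain `(Q, R)` passes through the layers `ℓ = 0, …, L - 1` in this order, one at each step,
and is absorbed from the last one. -/
structure IsLayeredChain (ℓ : S → Fin L) (Q : Matrix S S ℝ) (R : Matrix S K ℝ) : Prop where
  transition_eq_zero : ∀ s x, (ℓ x : ℕ) ≠ ℓ s + 1 → Q s x = 0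
  absorption_eq_zero : ∀ s k, (ℓ s : ℕ) + 1 ≠ L → R s k = 0
  sum_transition : ∀ s, (ℓ s : ℕ) + 1 < L → ∑ x, Q s x = 1

namespace IsLayeredChain

variable [DecidableEq S] {ℓ : S → Fin L} {Q : Matrix S S ℝ} {R : Matrix S K ℝ}
  (h : IsLayeredChain ℓ Q R)
include h

lemma pow_apply_eq_zero (j : ℕ) {s x : S} (hx : (ℓ x : ℕ) ≠ ℓ s + j) : (Q ^ j) s x = 0 := by
  induction j generalizing x with
  | zero => exact Matrix.one_apply_ne fun hsx => hx (by rw [hsx]; rfl)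
  | succ j ih =>
    rw [pow_succ, Matrix.mul_apply]
    refine Finset.sum_eq_zero fun y _ => ?_
    by_cases hy : (ℓ y : ℕ) = ℓ s + j
    · rw [h.transition_eq_zero y x (by omega), mul_zero]
    · rw [ih hy, zero_mul]

lemma sum_pow_apply (j : ℕ) {s : S} (hj : ℓ s + j < L) : ∑ x, (Q ^ j) s x = 1 := by
  induction j with
  | zero => simp [Matrix.one_apply]
  | succ j ih =>
    simp only [pow_succ, Matrix.mul_apply]
    rw [Finset.sum_comm, ← ih (by omega)]
    refine Finset.sum_congr rfl fun y _ => ?_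
    by_cases hy : (ℓ y : ℕ) = ℓ s + j
    · rw [← Finset.mul_sum, h.sum_transition y (by omega), mul_one]
    · simp only [h.pow_apply_eq_zero j hy, zero_mul, Finset.sum_const_zero]

lemma pow_mul_apply_eq_zero (j : ℕ) {s : S} (hj : ℓ s + j + 1 ≠ L) (k : K) :
    (Q ^ j * R) s k = 0 := by
  rw [Matrix.mul_apply]
  refine Finset.sum_eq_zero fun x _ => ?_
  by_cases hx : (ℓ x : ℕ) = ℓ s + j
  · rw [h.absorption_eq_zero x k (by omega), mul_zero]
  · rw [h.pow_apply_eq_zero j hx, zero_mul]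

lemma absorptionProb_apply {j : ℕ} {s : S} (hj : ℓ s + j + 1 = L) (k : K) :
    absorptionProb Q R s k = ∑ x, (Q ^ j) s x * R x k := by
  rw [← Matrix.mul_apply]
  exact tsum_eq_single j fun i hi => h.pow_mul_apply_eq_zero i (by omega) k

lemma absorptionProb_sub {j : ℕ} {s : S} (hj : ℓ s + j + 1 = L) (k : K) (p : ℝ) :
    absorptionProb Q R s k - p = ∑ x, (Q ^ j) s x * (R x k - p) := by
  simp only [mul_sub, Finset.sum_sub_distrib, ← Finset.sum_mul]
  rw [h.absorptionProb_apply hj, h.sum_pow_apply j (by omega), one_mul]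

lemma absorptionStep_iterate_eq_absorptionProb (P : Matrix S K ℝ) :
    (absorptionStep Q R)^[L] P = absorptionProb Q R := by
  ext s k
  have hpow : (Q ^ L * P) s k = 0 := by
    rw [Matrix.mul_apply]
    exact Finset.sum_eq_zero fun x _ => by rw [h.pow_apply_eq_zero L (by omega), zero_mul]
  rw [absorptionStep_iterate, Matrix.add_apply, hpow, zero_add, Matrix.sum_apply]
  refine (tsum_eq_sum fun j hj => h.pow_mul_apply_eq_zero j ?_ k).symm
  have := Finset.mem_range.not.mp hj
  omega

end IsLayeredChain

end LayeredChain

lemma IsRowStochastic.mem_Icc {S K : Type*} [Fintype K] {P : Matrix S K ℝ}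
    (hP : IsRowStochastic P) (s : S) (k : K) : P s k ∈ Set.Icc (0 : ℝ) 1 :=
  ⟨hP.1 s k, hP.2 s ▸ Finset.single_le_sum (fun k _ => hP.1 s k) (Finset.mem_univ k)⟩

section EmpiricalChain

variable {N L : ℕ} {S K : Type*} [DecidableEq S]

lemma empiricalQ_congr {D D' : Fin N → Trajectory L S K} (h : ∀ n, (D n).1 = (D' n).1) :
    empiricalQ D = empiricalQ D' := by
  have visitCount_eq : visitCount D = visitCount D' := by
    ext s
    simp [visitCount, h]
  have transitionCount_eq : transitionCount D = transitionCount D' := by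
    ext s x
    simp [transitionCount, h]
  unfold empiricalQ
  rw [visitCount_eq, transitionCount_eq]

variable (D : Fin N → Trajectory L S K) (s : S)

lemma sum_transitionCount [Fintype S] : ∑ x, transitionCount D s x =
    (Finset.univ.filter fun p : Fin N × Fin L =>
      (D p.1).1 p.2 = s ∧ p.2.val + 1 < L).card := by
  simp only [transitionCount, Finset.card_filter]
  rw [Finset.sum_comm]
  refine Finset.sum_congr rfl fun p _ => ?_
  by_cases hs : (D p.1).1 p.2 = s <;> by_cases hp : p.2.val + 1 < L <;> simp [hs, hp]

lemma empiricalQ_nonneg (x : S) : 0 ≤ empiricalQ D s x := by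
  unfold empiricalQ
  split_ifs <;> positivity

variable [DecidableEq K] (k : K)

lemma empiricalR_nonneg : 0 ≤ empiricalR D s k := by
  unfold empiricalR
  split_ifs <;> positivity

lemma outcomeCount_le_visitCount : outcomeCount D s k ≤ visitCount D s :=
  Finset.card_le_card (Finset.monotone_filter_right _ fun _ _ h => h.1)

lemma directEstimate_mem_Icc {P : Matrix S K ℝ} (hP : P s k ∈ Set.Icc (0 : ℝ) 1) :
    directEstimate P D s k ∈ Set.Icc (0 : ℝ) 1 := by
  unfold directEstimate
  split_ifs
  · exact hP
  · exact ⟨by positivity, div_le_one_of_le₀ (mod_cast outcomeCount_le_visitCount D s k)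
      (Nat.cast_nonneg _)⟩

variable [Fintype S]

lemma sum_transitionCount_add_absorptionCount_le :
    ∑ x, transitionCount D s x + absorptionCount D s k ≤ visitCount D s := by
  have split_last := Finset.card_filter_add_card_filter_not
    (s := Finset.univ.filter fun p : Fin N × Fin L => (D p.1).1 p.2 = s)
    (fun p => p.2.val + 1 < L)
  rw [Finset.filter_filter, Finset.filter_filter] at split_last
  rw [sum_transitionCount, visitCount, ← split_last, add_le_add_iff_left]
  refine Finset.card_le_card (Finset.monotone_filter_right _ fun p _ hp => ⟨hp.1, ?_⟩)
  have := hp.2.1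
  omega

lemma sum_empiricalQ_add_empiricalR_le_one :
    ∑ x, empiricalQ D s x + empiricalR D s k ≤ 1 := by
  unfold empiricalQ empiricalR
  split_ifs with hs
  · simp
  · rw [← Finset.sum_div, ← add_div]
    exact div_le_one_of_le₀ (mod_cast sum_transitionCount_add_absorptionCount_le D s k)
      (Nat.cast_nonneg _)

lemma absorptionStep_empirical_of_visitCount_eq_zero (hs : visitCount D s = 0)
    (P : Matrix S K ℝ) : absorptionStep (empiricalQ D) (empiricalR D) P s = P s := by
  ext k
  simp [absorptionStep_apply, empiricalQ, empiricalR, hs]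

end EmpiricalChain

section EmpiricalChainPowers

variable {N L : ℕ} {S K : Type*} [DecidableEq S] [Fintype S] [Nonempty K]

lemma empiricalQ_pow_apply_mem_Icc (D : Fin N → Trajectory L S K) (j : ℕ) (s x : S) :
    (empiricalQ D ^ j) s x ∈ Set.Icc (0 : ℝ) 1 := by
  classical
  refine pow_apply_mem_Icc (empiricalQ_nonneg D) (fun s => ?_) j s x
  have k := Classical.arbitrary K
  linarith [sum_empiricalQ_add_empiricalR_le_one D s k, empiricalR_nonneg D s k]

end EmpiricalChainPowers

section LayeredData

variable {N L : ℕ} {S K : Type*}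

/-- The trajectory is in layer `t` at position `t`, as every trajectory of a chain with layers `ℓ`
that starts in the first one. -/
def IsLayered (ℓ : S → Fin L) (τ : Trajectory L S K) : Prop :=
  ∀ t, ℓ (τ.1 t) = t

variable [DecidableEq S] {ℓ : S → Fin L} {D : Fin N → Trajectory L S K}
  (hD : ∀ n, IsLayered ℓ (D n))
include hD

lemma card_filter_occurrence_of_isLayered (s : S) (p : Fin N → Fin L → Prop)
    [∀ n, DecidablePred (p n)] :
    (Finset.univ.filter fun q : Fin N × Fin L => (D q.1).1 q.2 = s ∧ p q.1 q.2).card =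
      (Finset.univ.filter fun n => (D n).1 (ℓ s) = s ∧ p n (ℓ s)).card := by
  have layer_eq : ∀ q : Fin N × Fin L, (D q.1).1 q.2 = s → q.2 = ℓ s := fun q hq => by
    rw [← hq, hD q.1]
  refine Finset.card_nbij' Prod.fst (fun n => (n, ℓ s)) ?_ ?_ ?_ ?_
  · simp only [Set.MapsTo, Finset.coe_filter, Finset.mem_univ, true_and, Set.mem_ofPred_eq]
    intro q hq
    rwa [← layer_eq q hq.1]
  · simp [Set.MapsTo]
  · intro q hq
    simp only [Finset.coe_filter, Finset.mem_univ, true_and, Set.mem_ofPred_eq] at hq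
    exact Prod.ext rfl (layer_eq q hq.1).symm
  · simp [Set.LeftInvOn, Set.RightInvOn]

lemma visitCount_of_isLayered (s : S) :
    visitCount D s = (Finset.univ.filter fun n => (D n).1 (ℓ s) = s).card := by
  simpa [visitCount] using card_filter_occurrence_of_isLayered hD s fun _ _ => True

lemma transitionCount_of_isLayered {s x : S} (hx : (ℓ x : ℕ) = ℓ s + 1) :
    transitionCount D s x =
      (Finset.univ.filter fun n => (D n).1 (ℓ s) = s ∧ (D n).1 (ℓ x) = x).card := by
  rw [transitionCount, card_filter_occurrence_of_isLayered hD s fun n t =>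
    ∃ h : t.val + 1 < L, (D n).1 ⟨t.val + 1, h⟩ = x]
  simp only [← hx, Fin.is_lt, exists_true_left, Fin.eta]

lemma transitionCount_eq_zero_of_isLayered {s x : S} (hx : (ℓ x : ℕ) ≠ ℓ s + 1) :
    transitionCount D s x = 0 := by
  refine Finset.card_eq_zero.mpr (Finset.filter_eq_empty_iff.mpr ?_)
  rintro p - ⟨rfl, h, rfl⟩
  exact hx (by rw [hD, hD])

lemma sum_transitionCount_of_isLayered [Fintype S] {s : S} (hs : (ℓ s : ℕ) + 1 < L) :
    ∑ x, transitionCount D s x = visitCount D s := by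
  rw [sum_transitionCount, card_filter_occurrence_of_isLayered hD s fun _ t => t.val + 1 < L,
    visitCount_of_isLayered hD]
  simp only [hs, and_true]

lemma empiricalQ_eq_zero_of_isLayered {s x : S} (hs : visitCount D s ≠ 0)
    (hx : (ℓ x : ℕ) ≠ ℓ s + 1) : empiricalQ D s x = 0 := by
  rw [empiricalQ, if_neg hs, transitionCount_eq_zero_of_isLayered hD hx, Nat.cast_zero, zero_div]

variable [DecidableEq K]

lemma absorptionCount_eq_outcomeCount_of_isLayered {s : S} (hs : (ℓ s : ℕ) + 1 = L) (k : K) :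
    absorptionCount D s k = outcomeCount D s k := by
  refine congrArg Finset.card (Finset.filter_congr fun p _ => and_congr_right fun hp => ?_)
  rw [← hD p.1 p.2, hp]
  exact and_iff_right hs

lemma absorptionCount_eq_zero_of_isLayered {s : S} (hs : (ℓ s : ℕ) + 1 ≠ L) (k : K) :
    absorptionCount D s k = 0 := by
  refine Finset.card_eq_zero.mpr (Finset.filter_eq_empty_iff.mpr ?_)
  rintro p - ⟨rfl, h, -⟩
  exact hs (by rw [hD, h])

lemma empiricalR_eq_directEstimate {s : S} (hvisit : visitCount D s ≠ 0)
    (hs : (ℓ s : ℕ) + 1 = L) (P : Matrix S K ℝ) (k : K) :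
    empiricalR D s k = directEstimate P D s k := by
  rw [empiricalR, directEstimate, if_neg hvisit, if_neg hvisit,
    absorptionCount_eq_outcomeCount_of_isLayered hD hs]

variable [Fintype S]

lemma isLayeredChain_empirical (hvisit : ∀ s, visitCount D s ≠ 0) :
    IsLayeredChain ℓ (empiricalQ D) (empiricalR D) where
  transition_eq_zero s _ := empiricalQ_eq_zero_of_isLayered hD (hvisit s)
  absorption_eq_zero s k hs := by
    rw [empiricalR, if_neg (hvisit s), absorptionCount_eq_zero_of_isLayered hD hs, Nat.cast_zero,
      zero_div]
  sum_transition s hs := by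
    simp only [empiricalQ, if_neg (hvisit s)]
    rw [← Finset.sum_div, ← Nat.cast_sum, sum_transitionCount_of_isLayered hD hs,
      div_self (mod_cast hvisit s)]

lemma indirectEstimate_of_isLayered (P : Matrix S K ℝ) :
    indirectEstimate P D = (absorptionStep (empiricalQ D) (empiricalR D))^[L] P := by
  ext s k
  have frozen_or_advancing : ∀ s,
      (∀ P, absorptionStep (empiricalQ D) (empiricalR D) P s = P s) ∨
        ∀ x, (ℓ x : ℕ) ≠ ℓ s + 1 → empiricalQ D s x = 0 := fun s => by
    by_cases hs : visitCount D s = 0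
    · exact .inl (absorptionStep_empirical_of_visitCount_eq_zero D s hs)
    · exact .inr fun _ => empiricalQ_eq_zero_of_isLayered hD hs
  refine (tendsto_atTop_of_eventually_const (i₀ := L) fun i hi => ?_).limUnder_eq
  change ((absorptionStep (empiricalQ D) (empiricalR D))^[i] P) s k = _
  induction i, hi using Nat.le_induction with
  | base => rfl
  | succ i hi ih =>
    rw [absorptionStep_iterate_succ_apply frozen_or_advancing i (by omega), ih]

lemma indirectEstimate_mem_Icc {P : Matrix S K ℝ} {k : K} (hP : ∀ s, P s k ∈ Set.Icc (0 : ℝ) 1)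
    (s : S) : indirectEstimate P D s k ∈ Set.Icc (0 : ℝ) 1 := by
  rw [indirectEstimate_of_isLayered hD]
  exact absorptionStep_iterate_mem_Icc (empiricalQ_nonneg D) (empiricalR_nonneg D · k)
    (sum_empiricalQ_add_empiricalR_le_one D · k) hP L s

lemma indirectEstimate_eq_absorptionProb (hvisit : ∀ s, visitCount D s ≠ 0)
    (P : Matrix S K ℝ) :
    indirectEstimate P D = absorptionProb (empiricalQ D) (empiricalR D) := by
  rw [indirectEstimate_of_isLayered hD,
    (isLayeredChain_empirical hD hvisit).absorptionStep_iterate_eq_absorptionProb]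

lemma indirectEstimate_sub (hvisit : ∀ s, visitCount D s ≠ 0) (P : Matrix S K ℝ) {j : ℕ} {s : S}
    (hj : ℓ s + j + 1 = L) (k : K) (p : ℝ) :
    indirectEstimate P D s k - p =
      ∑ x, (empiricalQ D ^ j) s x * (directEstimate P D x k - p) := by
  have hchain := isLayeredChain_empirical hD hvisit
  rw [indirectEstimate_eq_absorptionProb hD hvisit, hchain.absorptionProb_sub hj]
  refine Finset.sum_congr rfl fun x _ => ?_
  by_cases hx : (ℓ x : ℕ) = ℓ s + j
  · rw [empiricalR_eq_directEstimate hD (hvisit x) (by omega) P]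
  · rw [hchain.pow_apply_eq_zero j hx, zero_mul, zero_mul]

end LayeredData

section Frequency

lemma sum_range_boole_eq_card_filter_fin (N : ℕ) (q : ℕ → Prop) [DecidablePred q] :
    ∑ n ∈ Finset.range N, (if q n then (1 : ℝ) else 0) =
      (Finset.univ.filter fun n : Fin N => q n).card := by
  rw [Finset.sum_range, Finset.sum_boole]

variable {Ω E : Type*} [MeasurableSpace Ω] [MeasurableSpace E] {μ : Measure Ω} {X : ℕ → Ω → E}

/-- The variables `X n` are independent and identically distributed; the common law is that of
`X 0`. -/
structure IsIID (X : ℕ → Ω → E) (μ : Measure Ω) : Prop where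
  measurable : ∀ n, Measurable (X n)
  indep : iIndepFun X μ
  identDistrib : ∀ n, IdentDistrib (X n) (X 0) μ μ

namespace IsIID

variable (h : IsIID X μ) {p : E → Prop} [DecidablePred p] (hp : MeasurableSet {x | p x})
include h

lemma measurable_data (N : ℕ) : Measurable fun ω (n : Fin N) => X n ω :=
  measurable_pi_iff.mpr fun n => h.measurable n

include hp

lemma integral_ite (n : ℕ) :
    ∫ ω, (if p (X n ω) then (1 : ℝ) else 0) ∂μ = μ.real (X 0 ⁻¹' {x | p x}) := by
  calc ∫ ω, (if p (X n ω) then (1 : ℝ) else 0) ∂μ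
      = ∫ ω, (X n ⁻¹' {x | p x}).indicator 1 ω ∂μ := by
        simp only [Set.indicator, Set.mem_preimage, Set.mem_ofPred_eq, Pi.one_apply]
    _ = μ.real (X 0 ⁻¹' {x | p x}) := by
        rw [integral_indicator_one (h.measurable n hp), measureReal_def,
          (h.identDistrib n).measure_mem_eq hp, measureReal_def]

lemma tendsto_frequency_ae [IsProbabilityMeasure μ] :
    ∀ᵐ ω ∂μ, Tendsto
      (fun N : ℕ => ((Finset.univ.filter fun n : Fin N => p (X n ω)).card : ℝ) / N) atTop
      (𝓝 (μ.real (X 0 ⁻¹' {x | p x}))) := by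
  set f : E → ℝ := fun x => if p x then 1 else 0
  have hf : Measurable f := Measurable.ite hp measurable_const measurable_const
  have hint : Integrable (fun ω => f (X 0 ω)) μ :=
    .of_bound (hf.comp (h.measurable 0)).aestronglyMeasurable 1
      (ae_of_all _ fun ω => by simp only [f]; split_ifs <;> simp)
  filter_upwards [strong_law_ae_real (fun n ω => f (X n ω)) hint
    (fun i j hij => (h.indep.indepFun hij).comp hf hf) fun n => (h.identDistrib n).comp hf]
    with ω hω
  simpa only [f, h.integral_ite hp, sum_range_boole_eq_card_filter_fin] using hω

/-- Hoeffding's inequality for the lower tail. -/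
lemma measureReal_frequency_le [IsProbabilityMeasure μ] {ε : ℝ} (hε : 0 ≤ ε) (N : ℕ) :
    μ.real {ω | ((Finset.univ.filter fun n : Fin N => p (X n ω)).card : ℝ) ≤
      N * (μ.real (X 0 ⁻¹' {x | p x}) - ε)} ≤ Real.exp (-(2 * ε ^ 2 * N)) := by
  set f : E → ℝ := fun x => -if p x then 1 else 0
  have hf : Measurable f := (Measurable.ite hp measurable_const measurable_const).neg
  have integral_f : ∀ n, ∫ ω, f (X n ω) ∂μ = -μ.real (X 0 ⁻¹' {x | p x}) := fun n => by
    simp only [f, integral_neg, h.integral_ite hp]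
  have subgaussian : ∀ n, HasSubgaussianMGF
      (fun ω => f (X n ω) - -μ.real (X 0 ⁻¹' {x | p x})) ((‖(0 : ℝ) - -1‖₊ / 2) ^ 2) μ :=
      fun n => by
    rw [← integral_f n]
    refine hasSubgaussianMGF_of_mem_Icc (hf.comp (h.measurable n)).aemeasurable
      (ae_of_all _ fun ω => ?_)
    simp only [f]
    split_ifs <;> simp
  have hoeffding := HasSubgaussianMGF.measure_sum_range_ge_le_of_iIndepFun
    (h.indep.comp (fun _ x => f x - -μ.real (X 0 ⁻¹' {x | p x})) fun _ => hf.sub_const _)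
    (fun n (_ : n < N) => subgaussian n) (ε := N * ε) (by positivity)
  refine (measureReal_mono fun ω hω => ?_).trans (hoeffding.trans_eq ?_)
  · simp only [Set.mem_ofPred_eq, f, Function.comp_apply, Finset.sum_sub_distrib,
      Finset.sum_neg_distrib, sum_range_boole_eq_card_filter_fin, Finset.sum_const,
      Finset.card_range, nsmul_eq_mul] at hω ⊢
    linarith
  · congr 1
    rcases eq_or_ne (N : ℝ) 0 with hN | hN
    · simp [hN]
    · simp
      field_simp

lemma tendsto_mul_measureReal_frequency_le [IsProbabilityMeasure μ]
    (hpos : 0 < μ.real (X 0 ⁻¹' {x | p x})) :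
    Tendsto (fun N : ℕ => (N : ℝ) *
      μ.real {ω | ((Finset.univ.filter fun n : Fin N => p (X n ω)).card : ℝ) ≤
        N * (μ.real (X 0 ⁻¹' {x | p x}) / 2)}) atTop (𝓝 0) := by
  set q := μ.real (X 0 ⁻¹' {x | p x})
  have exp_lim : Tendsto (fun N : ℕ => (N : ℝ) * Real.exp (-(q ^ 2 / 2 * N))) atTop (𝓝 0) := by
    have := ((Real.tendsto_pow_mul_exp_neg_atTop_nhds_zero 1).comp
      (tendsto_natCast_atTop_atTop.const_mul_atTop (half_pos (pow_pos hpos 2)))).const_mul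
        (q ^ 2 / 2)⁻¹
    refine (mul_zero (_ : ℝ) ▸ this).congr fun N => ?_
    simp only [Function.comp_apply, pow_one]
    field_simp
  refine squeeze_zero (fun N => by positivity) (fun N => ?_) exp_lim
  have := h.measureReal_frequency_le hp (half_pos hpos).le N
  rw [sub_half, div_pow] at this
  refine mul_le_mul_of_nonneg_left (this.trans_eq ?_) N.cast_nonneg
  congr 2
  ring

end IsIID

end Frequency

section NegligibleEvents

variable {Ω : Type*} [MeasurableSpace Ω] {μ : Measure Ω} [IsFiniteMeasure μ]

lemma tendsto_mul_integral_sq_congr {U V : ℕ → Ω → ℝ} {C l : ℝ}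
    (hUm : ∀ N, Measurable (U N)) (hVm : ∀ N, Measurable (V N))
    (hU : ∀ N, ∀ᵐ ω ∂μ, |U N ω| ≤ C) (hV : ∀ N, ∀ᵐ ω ∂μ, |V N ω| ≤ C)
    (hUV : Tendsto (fun N : ℕ => (N : ℝ) * μ.real {ω | U N ω ≠ V N ω}) atTop (𝓝 0))
    (hlim : Tendsto (fun N : ℕ => (N : ℝ) * ∫ ω, V N ω ^ 2 ∂μ) atTop (𝓝 l)) :
    Tendsto (fun N : ℕ => (N : ℝ) * ∫ ω, U N ω ^ 2 ∂μ) atTop (𝓝 l) := by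
  have sq_bound : ∀ {x : ℝ}, |x| ≤ C → |x ^ 2| ≤ C ^ 2 := fun {x} hx => by
    rw [abs_pow]
    gcongr
  have integrable_sq : ∀ {f : Ω → ℝ}, Measurable f → (∀ᵐ ω ∂μ, |f ω| ≤ C) →
      Integrable (fun ω => f ω ^ 2) μ := fun hfm hf =>
    .of_bound (hfm.pow_const 2).aestronglyMeasurable (C ^ 2) (hf.mono fun _ => sq_bound)
  have difference_le : ∀ N, |∫ ω, (U N ω ^ 2 - V N ω ^ 2) ∂μ| ≤
      (C ^ 2 + C ^ 2) * μ.real {ω | U N ω ≠ V N ω} := fun N => by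
    rw [← setIntegral_eq_integral_of_forall_compl_eq_zero (s := {ω | U N ω ≠ V N ω}) fun ω hω => by
      rw [not_not.mp hω, sub_self], ← Real.norm_eq_abs]
    refine norm_setIntegral_le_of_norm_le_const_ae' (measure_lt_top μ _) ?_
    filter_upwards [hU N, hV N] with ω hUω hVω _
    exact (abs_sub _ _).trans (add_le_add (sq_bound hUω) (sq_bound hVω))
  have difference_lim :
      Tendsto (fun N : ℕ => (N : ℝ) * ∫ ω, (U N ω ^ 2 - V N ω ^ 2) ∂μ) atTop (𝓝 0) := by
    refine squeeze_zero_norm (fun N => ?_) (mul_zero (C ^ 2 + C ^ 2) ▸ hUV.const_mul _)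
    rw [norm_mul, Real.norm_natCast, mul_left_comm]
    exact mul_le_mul_of_nonneg_left (difference_le N) N.cast_nonneg
  refine (zero_add l ▸ difference_lim.add hlim).congr fun N => ?_
  rw [integral_sub (integrable_sq (hUm N) (hU N)) (integrable_sq (hVm N) (hV N))]
  ring

end NegligibleEvents

section SignReversal

variable {Ω E : Type*} [MeasurableSpace Ω] [MeasurableSpace E] {μ : Measure Ω} {X : ℕ → Ω → E}
  {g : E → E} {N : ℕ}

lemma IsIID.integral_update (h : IsIID X μ) (hg : Measurable g)
    (hgX : IdentDistrib (g ∘ X 0) (X 0) μ μ) (j : Fin N) {F : (Fin N → E) → ℝ}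
    (hF : Measurable F) :
    ∫ ω, F (Function.update (fun n : Fin N => X n ω) j (g (X j ω))) ∂μ =
      ∫ ω, F (fun n => X n ω) ∂μ := by
  let G : Fin N → E → E := Function.update (fun _ => id) j g
  have measurable_G : ∀ n, Measurable (G n) := fun n => by
    rcases eq_or_ne n j with rfl | hn
    · simpa [G] using hg
    · simpa [G, hn] using measurable_id
  have update_eq : ∀ ω, Function.update (fun n : Fin N => X n ω) j (g (X j ω)) =
      fun n => (G n ∘ X n) ω := fun ω => by
    ext n
    rcases eq_or_ne n j with rfl | hn <;> simp [G, *]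
  have identDistrib_G : ∀ n : Fin N, IdentDistrib (G n ∘ X n) (X n) μ μ := fun n => by
    rcases eq_or_ne n j with rfl | hn
    · simpa [G] using
        (((h.identDistrib n).comp hg).trans hgX).trans (h.identDistrib n).symm
    · simpa [G, hn] using IdentDistrib.refl (h.measurable n).aemeasurable
  have indep : iIndepFun (fun n : Fin N => X n) μ := h.indep.precomp Fin.val_injective
  simp only [update_eq]
  exact ((IdentDistrib.pi identDistrib_G (indep.comp _ measurable_G) indep).comp hF).integral_eq

variable [Finite E] [MeasurableSingletonClass E]

lemma IsIID.integrable_data [IsFiniteMeasure μ] (h : IsIID X μ) (F : (Fin N → E) → ℝ) :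
    Integrable (fun ω => F fun n => X n ω) μ :=
  (Integrable.of_finite (f := F)).comp_measurable (h.measurable_data N)

/-- Reversing the sign of a single `ε (X n)` preserves the law of the data, so the mixed terms of
the square integrate to zero. -/
lemma IsIID.integral_sum_mul_sq [IsFiniteMeasure μ] (h : IsIID X μ)
    (hgX : IdentDistrib (g ∘ X 0) (X 0) μ μ) {ε : E → ℝ} {v : ℝ} (hεg : ∀ x, ε (g x) = -ε x)
    (hε : ∀ x, ε x ^ 2 = v) {a : Fin N → (Fin N → E) → ℝ}
    (ha : ∀ n j D, a n (Function.update D j (g (D j))) = a n D) :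
    ∫ ω, (∑ n, a n (fun n => X n ω) * ε (X n ω)) ^ 2 ∂μ =
      v * ∫ ω, ∑ n, a n (fun n => X n ω) ^ 2 ∂μ := by
  let F : Fin N → Fin N → (Fin N → E) → ℝ := fun i j D => a i D * ε (D i) * (a j D * ε (D j))
  have mixed_term : ∀ i j, j ≠ i → ∫ ω, F i j (fun n => X n ω) ∂μ = 0 := fun i j hij => by
    have := h.integral_update (.of_discrete) hgX i (.of_discrete : Measurable (F i j))
    simp only [F, ha, Function.update_self, Function.update_of_ne hij, hεg, mul_neg, neg_mul,
      integral_neg] at this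
    linarith
  have square_term : ∀ i D, F i i D = v * a i D ^ 2 := fun i D => by
    rw [← hε (D i)]
    ring
  calc ∫ ω, (∑ n, a n (fun n => X n ω) * ε (X n ω)) ^ 2 ∂μ
      = ∑ i, ∑ j, ∫ ω, F i j (fun n => X n ω) ∂μ := by
        simp only [sq, Finset.sum_mul_sum]
        rw [integral_finsetSum _ fun i _ => integrable_finsetSum _ fun j _ =>
          h.integrable_data (F i j)]
        exact Finset.sum_congr rfl fun i _ =>
          integral_finsetSum _ fun j _ => h.integrable_data (F i j)
    _ = ∑ i, v * ∫ ω, a i (fun n => X n ω) ^ 2 ∂μ := by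
        refine Finset.sum_congr rfl fun i _ => ?_
        rw [Finset.sum_eq_single i (fun j _ => mixed_term i j) (by simp), ← integral_const_mul]
        simp only [square_term]
    _ = v * ∫ ω, ∑ n, a n (fun n => X n ω) ^ 2 ∂μ := by
        rw [integral_finsetSum _ fun n _ => h.integrable_data fun D => a n D ^ 2, Finset.mul_sum]

end SignReversal

section StratifiedMean

variable {E S : Type*} {N : ℕ}

lemma apply_update_of_invariant {g : E → E} {c : E → S} (hcg : ∀ x, c (g x) = c x) (j n : Fin N)
    (D : Fin N → E) : c (Function.update D j (g (D j)) n) = c (D n) := by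
  rcases eq_or_ne n j with rfl | hn <;> simp [*]

variable [DecidableEq S]

/-- Number of data points in the stratum `c = s`. -/
def stratumCount (c : E → S) (D : Fin N → E) (s : S) : ℕ :=
  (Finset.univ.filter fun n => c (D n) = s).card

/-- Weighted sum over the strata of `c` of the mean of `ε` in each of them; an empty stratum
contributes `0`, as `x / 0 = 0`. Both estimators have errors of this form. -/
noncomputable def stratifiedMean [Fintype S] (c : E → S) (ε : E → ℝ) (w : S → ℝ)
    (D : Fin N → E) : ℝ :=
  ∑ s, w s * ((∑ n with c (D n) = s, ε (D n)) / stratumCount c D s)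

/-- The weights `w`, set to zero on the strata that contain at most half of the data points
expected there. -/
noncomputable def truncatedWeight (c : E → S) (p w : S → ℝ) (D : Fin N → E) (s : S) : ℝ :=
  if N * (p s / 2) < stratumCount c D s then w s else 0

variable {c : E → S}

lemma abs_truncatedWeight_le {p w : S → ℝ} {D : Fin N → E} {s : S} {b : ℝ}
    (hw : |w s| ≤ b) : |truncatedWeight c p w D s| ≤ b := by
  unfold truncatedWeight
  split_ifs
  · exact hw
  · simpa using (abs_nonneg _).trans hw

lemma mul_truncatedWeight_sq_div_le {p w : S → ℝ} {D : Fin N → E} {s : S}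
    (hp : 0 < p s) (hw : |w s| ≤ 1) :
    N * (truncatedWeight c p w D s ^ 2 / stratumCount c D s) ≤ 2 / p s := by
  unfold truncatedWeight
  split_ifs with hcount
  · have count_pos : (0 : ℝ) < stratumCount c D s := lt_of_le_of_lt (by positivity) hcount
    have sq_le_one : w s ^ 2 ≤ 1 := (sq_le_one_iff_abs_le_one _).mpr hw
    rw [mul_div_assoc', div_le_div_iff₀ count_pos hp]
    nlinarith
  · simp only [ne_eq, OfNat.ofNat_ne_zero, not_false_eq_true, zero_pow, zero_div, mul_zero]
    positivity

lemma stratumCount_update {g : E → E} (hcg : ∀ x, c (g x) = c x) (j : Fin N) (D : Fin N → E) :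
    stratumCount c (Function.update D j (g (D j))) = stratumCount c D := by
  ext s
  simp only [stratumCount, apply_update_of_invariant hcg]

variable [Fintype S] (c : E → S) (ε : E → ℝ) (w : S → ℝ) (D : Fin N → E)

lemma stratifiedMean_eq_sum :
    stratifiedMean c ε w D = ∑ n, w (c (D n)) / stratumCount c D (c (D n)) * ε (D n) := by
  rw [stratifiedMean, ← Finset.sum_fiberwise _ fun n => c (D n)]
  refine Finset.sum_congr rfl fun s _ => ?_
  rw [mul_div_left_comm, mul_comm, Finset.mul_sum]
  refine Finset.sum_congr rfl fun n hn => ?_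
  rw [(Finset.mem_filter.mp hn).2]

lemma sum_weight_div_stratumCount_sq :
    ∑ n, (w (c (D n)) / stratumCount c D (c (D n))) ^ 2 = ∑ s, w s ^ 2 / stratumCount c D s := by
  rw [← Finset.sum_fiberwise _ fun n => c (D n)]
  refine Finset.sum_congr rfl fun s _ => ?_
  rw [Finset.sum_congr rfl fun n hn => by rw [(Finset.mem_filter.mp hn).2], Finset.sum_const,
    nsmul_eq_mul]
  change (stratumCount c D s : ℝ) * _ = _
  rcases eq_or_ne (stratumCount c D s : ℝ) 0 with hs | hs
  · simp [hs]
  · field_simp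

variable {c ε w D}

lemma abs_stratifiedMean_le {b : ℝ} (hb : 0 ≤ b) (hε : ∀ x, |ε x| ≤ b) (hw : ∀ s, |w s| ≤ 1) :
    |stratifiedMean c ε w D| ≤ Fintype.card S * b := by
  refine (Finset.abs_sum_le_sum_abs _ _).trans ?_
  rw [← nsmul_eq_mul, ← Finset.card_univ]
  refine Finset.sum_le_card_nsmul _ _ _ fun s _ => ?_
  have stratum_sum_le : |∑ n with c (D n) = s, ε (D n)| ≤ b * stratumCount c D s := by
    refine (Finset.abs_sum_le_sum_abs _ _).trans ?_
    rw [mul_comm, ← nsmul_eq_mul]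
    exact Finset.sum_le_card_nsmul _ _ _ fun n _ => hε _
  rw [abs_mul, abs_div, Nat.abs_cast]
  exact (mul_le_of_le_one_left (by positivity) (hw s)).trans
    (div_le_of_le_mul₀ (Nat.cast_nonneg _) hb stratum_sum_le)

end StratifiedMean

section StratumFrequency

variable {Ω E ι : Type*} [MeasurableSpace Ω] [MeasurableSpace E] {μ : Measure Ω}
  [IsProbabilityMeasure μ] {X : ℕ → Ω → E} [DiscreteMeasurableSpace E] [Finite ι]

lemma IsIID.tendsto_mul_measureReal_exists_frequency_le (h : IsIID X μ) {q : ι → E → Prop}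
    [∀ i, DecidablePred (q i)] {p : ι → ℝ} (hp : ∀ i, μ.real (X 0 ⁻¹' {x | q i x}) = p i)
    (hpos : ∀ i, 0 < p i) :
    Tendsto (fun N : ℕ => (N : ℝ) * μ.real
      {ω | ∃ i, ((Finset.univ.filter fun n : Fin N => q i (X n ω)).card : ℝ) ≤ N * (p i / 2)})
      atTop (𝓝 0) := by
  have each_lim : ∀ i, Tendsto (fun N : ℕ => (N : ℝ) * μ.real
      {ω | ((Finset.univ.filter fun n : Fin N => q i (X n ω)).card : ℝ) ≤ N * (p i / 2)})
      atTop (𝓝 0) := fun i => by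
    rw [← hp i]
    exact h.tendsto_mul_measureReal_frequency_le .of_discrete ((hp i).symm ▸ hpos i)
  cases nonempty_fintype ι
  have sum_lim := tendsto_finsetSum Finset.univ fun i _ => each_lim i
  rw [Finset.sum_const_zero] at sum_lim
  refine squeeze_zero (fun N => by positivity) (fun N => ?_) sum_lim
  rw [← Finset.mul_sum, Set.ofPred_exists]
  exact mul_le_mul_of_nonneg_left (measureReal_iUnion_fintype_le _) N.cast_nonneg

lemma IsIID.tendsto_stratumCount_div_ae (h : IsIID X μ) [DecidableEq ι] {c : E → ι} {p : ι → ℝ}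
    (hp : ∀ s, μ.real (X 0 ⁻¹' {x | c x = s}) = p s) :
    ∀ᵐ ω ∂μ, ∀ s, Tendsto (fun N : ℕ => (stratumCount c (fun n : Fin N => X n ω) s : ℝ) / N) atTop
      (𝓝 (p s)) := by
  refine ae_all_iff.mpr fun s => ?_
  rw [← hp s]
  exact h.tendsto_frequency_ae (p := fun x => c x = s) .of_discrete

end StratumFrequency

section StratifiedMeanOfIID

variable {Ω E S : Type*} [MeasurableSpace Ω] [MeasurableSpace E] {μ : Measure Ω}
  [IsProbabilityMeasure μ] {X : ℕ → Ω → E} [Finite E] [MeasurableSingletonClass E] [DecidableEq S]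
  [Fintype S] {c : E → S}

lemma IsIID.integral_stratifiedMean_sq (h : IsIID X μ) {g : E → E}
    (hgX : IdentDistrib (g ∘ X 0) (X 0) μ μ) (hcg : ∀ x, c (g x) = c x) {ε : E → ℝ} {v : ℝ}
    (hεg : ∀ x, ε (g x) = -ε x) (hε : ∀ x, ε x ^ 2 = v) {N : ℕ} {w : (Fin N → E) → S → ℝ}
    (hw : ∀ j D, w (Function.update D j (g (D j))) = w D) :
    ∫ ω, stratifiedMean c ε (w fun n => X n ω) (fun n : Fin N => X n ω) ^ 2 ∂μ =
      v * ∫ ω, ∑ s, w (fun n => X n ω) s ^ 2 / stratumCount c (fun n : Fin N => X n ω) s ∂μ := by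
  simp only [stratifiedMean_eq_sum, ← sum_weight_div_stratumCount_sq]
  refine h.integral_sum_mul_sq hgX hεg hε
    (a := fun n D => w D (c (D n)) / stratumCount c D (c (D n))) fun n j D => ?_
  simp only [hw, stratumCount_update hcg, apply_update_of_invariant hcg]

variable {p : S → ℝ} (hp : ∀ s, μ.real (X 0 ⁻¹' {x | c x = s}) = p s) (hpos : ∀ s, 0 < p s)
include hp hpos

lemma IsIID.tendsto_mul_integral_truncatedWeight_sq (h : IsIID X μ)
    {w : ∀ N, (Fin N → E) → S → ℝ} {w' : S → ℝ} (hw : ∀ N D s, |w N D s| ≤ 1)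
    (hlim : ∀ᵐ ω ∂μ, ∀ s, Tendsto (fun N => w N (fun n => X n ω) s) atTop (𝓝 (w' s))) :
    Tendsto (fun N : ℕ => (N : ℝ) * ∫ ω, ∑ s,
      truncatedWeight c p (w N fun n => X n ω) (fun n : Fin N => X n ω) s ^ 2 /
        stratumCount c (fun n : Fin N => X n ω) s ∂μ) atTop
      (𝓝 (∑ s, w' s ^ 2 / p s)) := by
  simp only [← integral_const_mul, Finset.mul_sum]
  have limit_eq : ∑ s, w' s ^ 2 / p s = ∫ _, ∑ s, w' s ^ 2 / p s ∂μ := by simp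
  rw [limit_eq]
  refine tendsto_integral_of_dominated_convergence (fun _ => ∑ s, 2 / p s)
    (fun N => (h.integrable_data fun D : Fin N → E => ∑ s, (N : ℝ) *
      (truncatedWeight c p (w N D) D s ^ 2 / stratumCount c D s)).aestronglyMeasurable)
    (integrable_const _) (fun N => ae_of_all _ fun ω => ?_) ?_
  · rw [Real.norm_of_nonneg (by positivity)]
    exact Finset.sum_le_sum fun s _ => mul_truncatedWeight_sq_div_le (hpos s) (hw N _ s)
  · filter_upwards [hlim, h.tendsto_stratumCount_div_ae hp] with ω hwω hcount
    refine tendsto_finsetSum _ fun s _ => ?_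
    have not_truncated : ∀ᶠ N : ℕ in atTop, w N (fun n => X n ω) s =
        truncatedWeight c p (w N fun n => X n ω) (fun n : Fin N => X n ω) s := by
      filter_upwards [(hcount s).eventually (lt_mem_nhds (half_lt_self (hpos s))),
        eventually_gt_atTop 0] with N hN hN0
      rw [lt_div_iff₀ (mod_cast hN0), mul_comm] at hN
      rw [truncatedWeight, if_pos hN]
    refine ((((hwω s).congr' not_truncated).pow 2).div (hcount s) (hpos s).ne').congr fun N => ?_
    simp only [Pi.div_apply, div_div_eq_mul_div]
    ring

lemma IsIID.tendsto_mul_integral_stratifiedMean_sq (h : IsIID X μ) {g : E → E}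
    (hgX : IdentDistrib (g ∘ X 0) (X 0) μ μ) (hcg : ∀ x, c (g x) = c x) {ε : E → ℝ} {v : ℝ}
    (hεg : ∀ x, ε (g x) = -ε x) (hε : ∀ x, ε x ^ 2 = v) {w : ∀ N, (Fin N → E) → S → ℝ}
    {w' : S → ℝ} (hw : ∀ N D s, |w N D s| ≤ 1)
    (hwg : ∀ N j D, w N (Function.update D j (g (D j))) = w N D)
    (hlim : ∀ᵐ ω ∂μ, ∀ s, Tendsto (fun N => w N (fun n => X n ω) s) atTop (𝓝 (w' s))) :
    Tendsto (fun N : ℕ => (N : ℝ) *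
      ∫ ω, stratifiedMean c ε (w N fun n => X n ω) (fun n : Fin N => X n ω) ^ 2 ∂μ) atTop
      (𝓝 (v * ∑ s, w' s ^ 2 / p s)) := by
  have abs_ε_le : ∀ x, |ε x| ≤ √v := fun x => by rw [← hε x, Real.sqrt_sq_eq_abs]
  have measurable_data : ∀ {N} (F : (Fin N → E) → ℝ), Measurable fun ω => F fun n => X n ω :=
    fun F => (Measurable.of_discrete (f := F)).comp (h.measurable_data _)
  refine tendsto_mul_integral_sq_congr (C := Fintype.card S * √v)
    (V := fun N ω => stratifiedMean c ε (truncatedWeight c p (w N fun n => X n ω) fun n => X n ω)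
      (fun n : Fin N => X n ω))
    (fun N => measurable_data fun D => stratifiedMean c ε (w N D) D)
    (fun N => measurable_data fun D => stratifiedMean c ε (truncatedWeight c p (w N D) D) D)
    (fun N => ae_of_all _ fun ω => abs_stratifiedMean_le (by positivity) abs_ε_le (hw N _))
    (fun N => ae_of_all _ fun ω => abs_stratifiedMean_le (by positivity) abs_ε_le fun s =>
      abs_truncatedWeight_le (hw N _ s)) ?_ ?_
  · refine squeeze_zero (fun N => by positivity) (fun N => ?_)
      (h.tendsto_mul_measureReal_exists_frequency_le hp hpos)
    refine mul_le_mul_of_nonneg_left (measureReal_mono fun ω hω => ?_) N.cast_nonneg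
    by_contra! hcount
    simp only [Set.mem_ofPred_eq, not_exists, not_le] at hcount
    exact hω (by simp only [stratifiedMean, truncatedWeight, stratumCount, hcount, if_true])
  · have truncatedWeight_update : ∀ N j (D : Fin N → E),
        truncatedWeight c p (w N (Function.update D j (g (D j)))) (Function.update D j (g (D j))) =
          truncatedWeight c p (w N D) D := fun N j D => by
      ext s
      simp only [truncatedWeight, hwg, stratumCount_update hcg]
    refine ((h.tendsto_mul_integral_truncatedWeight_sq hp hpos hw hlim).const_mul v).congr
      fun N => ?_
    rw [h.integral_stratifiedMean_sq hgX hcg hεg hε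
      (w := fun D => truncatedWeight c p (w N D) D) (truncatedWeight_update N)]
    ring

end StratifiedMeanOfIID

section UniformLayers

variable {T W : ℕ}

lemma isLayeredChain_layered : IsLayeredChain Prod.fst (layeredQ T W) (layeredR T W) where
  transition_eq_zero _ _ hx := if_neg hx
  absorption_eq_zero _ _ hs := if_neg hs
  sum_transition s hs := by
    have hW : (W : ℝ) ≠ 0 := mod_cast s.2.pos.ne'
    rw [Fintype.sum_prod_type, Finset.sum_eq_single ⟨s.1.val + 1, hs⟩]
    · simp [layeredQ, hW]
    · exact fun t _ ht => Finset.sum_eq_zero fun i _ => if_neg fun h => ht (Fin.ext h)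
    · simp

lemma absorptionProb_layered (s : Fin T × Fin W) (k : Fin 2) :
    absorptionProb (layeredQ T W) (layeredR T W) s k = 1 / 2 := by
  obtain ⟨j, hj⟩ : ∃ j, s.1.val + j + 1 = T := ⟨T - 1 - s.1.val, by omega⟩
  rw [← sub_eq_zero, isLayeredChain_layered.absorptionProb_sub hj]
  refine Finset.sum_eq_zero fun x _ => ?_
  by_cases hx : x.1.val = s.1.val + j
  · rw [layeredR, if_pos (by omega), sub_self, mul_zero]
  · rw [isLayeredChain_layered.pow_apply_eq_zero j hx, zero_mul]

lemma layeredQ_pow_succ_apply (j : ℕ) {s x : Fin T × Fin W} (hx : x.1.val = s.1.val + j + 1) :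
    (layeredQ T W ^ (j + 1)) s x = 1 / (W : ℝ) := by
  calc (layeredQ T W ^ (j + 1)) s x = ∑ y, (layeredQ T W ^ j) s y * layeredQ T W y x := by
        rw [pow_succ, Matrix.mul_apply]
    _ = ∑ y, (layeredQ T W ^ j) s y * (1 / (W : ℝ)) := by
        refine Finset.sum_congr rfl fun y _ => ?_
        by_cases hy : y.1.val = s.1.val + j
        · rw [layeredQ, if_pos (by omega)]
        · rw [isLayeredChain_layered.pow_apply_eq_zero j hy, zero_mul, zero_mul]
    _ = 1 / W := by
        rw [← Finset.sum_mul, isLayeredChain_layered.sum_pow_apply j (by omega), one_mul]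

lemma layeredQ_pow_apply_last [NeZero T] (hTW : T = 1 → W = 1) {u : Fin T} (hu : u.val + 1 = T)
    (m i : Fin W) : (layeredQ T W ^ u.val) (0, m) (u, i) = 1 / (W : ℝ) := by
  rcases hu0 : u.val with _ | j
  · obtain rfl : W = 1 := hTW (by omega)
    obtain rfl : u = 0 := Fin.ext hu0
    rw [pow_zero, Subsingleton.elim m i, Matrix.one_apply_eq, Nat.cast_one, div_one]
  · exact layeredQ_pow_succ_apply j (by simp [hu0])

end UniformLayers

section LayeredLaw

variable {T W : ℕ}

/-- The index within its layer of the state that the trajectory visits at position `u`. -/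
def layerIndex (u : Fin T) (τ : Trajectory T (Fin T × Fin W) (Fin 2)) : Fin W :=
  (τ.1 u).2

/-- The layered trajectory with given indices in the layers and given class. -/
def layeredTrajectory (f : (Fin T → Fin W) × Fin 2) : Trajectory T (Fin T × Fin W) (Fin 2) :=
  (fun t => (t, f.1 t), f.2)

lemma layeredTrajectory_injective :
    Function.Injective (layeredTrajectory (T := T) (W := W)) := by
  rintro ⟨f, y⟩ ⟨f', y'⟩ h
  simp only [layeredTrajectory, Prod.mk.injEq] at h
  exact Prod.ext (funext fun t => congrArg Prod.snd (congrFun h.1 t)) h.2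

lemma IsLayered.eq_layeredTrajectory {τ : Trajectory T (Fin T × Fin W) (Fin 2)}
    (hτ : IsLayered Prod.fst τ) : layeredTrajectory (fun u => layerIndex u τ, τ.2) = τ :=
  Prod.ext (funext fun t => Prod.ext (hτ t).symm rfl) rfl

lemma sum_uniform_indicator [NeZero W] (A : Finset (Fin T)) (g : Fin T → Fin W) :
    ∑ f : Fin T → Fin W, (if ∀ u ∈ A, f u = g u then (1 / (W : ℝ)) ^ T else 0) =
      (1 / (W : ℝ)) ^ A.card := by
  have ite_eq_prod : ∀ f : Fin T → Fin W,
      (if ∀ u ∈ A, f u = g u then (1 / (W : ℝ)) ^ T else 0) =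
        ∏ u, if u ∈ A → f u = g u then 1 / (W : ℝ) else 0 := fun f => by
    simp [Fintype.prod_ite_zero]
  have factor_eq : ∀ u, (∑ x, if u ∈ A → x = g u then 1 / (W : ℝ) else 0) =
      if u ∈ A then 1 / (W : ℝ) else 1 := fun u => by
    by_cases hu : u ∈ A <;> simp [hu]
  simp only [ite_eq_prod]
  rw [← Fintype.prod_sum fun u x => if u ∈ A → x = g u then 1 / (W : ℝ) else 0]
  simp only [factor_eq]
  rw [Finset.prod_ite_mem, Finset.univ_inter, Finset.prod_const]

/-- The deviation from `1 / 2` of the indicator of class `k`. -/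
noncomputable def centeredClass (k : Fin 2) (τ : Trajectory T (Fin T × Fin W) (Fin 2)) : ℝ :=
  (if τ.2 = k then 1 else 0) - 1 / 2

/-- Exchanges the two classes. -/
def flipClass (τ : Trajectory T (Fin T × Fin W) (Fin 2)) :
    Trajectory T (Fin T × Fin W) (Fin 2) :=
  (τ.1, τ.2.rev)

lemma centeredClass_flipClass (k : Fin 2) (τ : Trajectory T (Fin T × Fin W) (Fin 2)) :
    centeredClass k (flipClass τ) = -centeredClass k τ := by
  have rev_eq_iff : τ.2.rev = k ↔ ¬ τ.2 = k := by
    generalize τ.2 = y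
    decide +revert
  simp only [centeredClass, flipClass, rev_eq_iff]
  split_ifs <;> norm_num

lemma centeredClass_sq (k : Fin 2) (τ : Trajectory T (Fin T × Fin W) (Fin 2)) :
    centeredClass k τ ^ 2 = 1 / 4 := by
  unfold centeredClass
  split_ifs <;> norm_num

lemma flipClass_involutive : Function.Involutive (flipClass (T := T) (W := W)) :=
  fun _ => Prod.ext rfl (Fin.rev_rev _)

variable [NeZero T]

/-- The law of a trajectory of the layered chain started uniformly in the first layer. -/
noncomputable abbrev layeredProb (τ : Trajectory T (Fin T × Fin W) (Fin 2)) : ℝ :=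
  trajectoryProb (layeredInit T W) (layeredQ T W) (layeredR T W) τ

lemma isLayered_of_layeredProb_ne_zero {τ : Trajectory T (Fin T × Fin W) (Fin 2)}
    (h : layeredProb τ ≠ 0) : IsLayered Prod.fst τ := by
  have init_ne_zero := left_ne_zero_of_mul h
  have step_ne_zero := Finset.prod_ne_zero_iff.mp (right_ne_zero_of_mul h)
  suffices ∀ n (hn : n < T), (τ.1 ⟨n, hn⟩).1.val = n from fun t => Fin.ext (this t.val t.isLt)
  intro n
  induction n with
  | zero => exact fun _ => by_contra fun h0 => init_ne_zero (if_neg h0)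
  | succ n ih =>
    intro hn
    have step_n := step_ne_zero ⟨n, by omega⟩ (Finset.mem_univ _)
    rw [dif_pos hn] at step_n
    by_contra hlayer
    exact step_n (if_neg (by rwa [ih (by omega)]))

lemma layeredProb_layeredTrajectory (f : (Fin T → Fin W) × Fin 2) :
    layeredProb (layeredTrajectory f) = (1 / (W : ℝ)) ^ T * (1 / 2) := by
  obtain ⟨n, rfl⟩ := Nat.exists_eq_succ_of_ne_zero (NeZero.ne T)
  simp [layeredProb, trajectoryProb, layeredTrajectory, layeredInit, layeredQ, layeredR,
    Fin.prod_univ_castSucc, pow_succ', mul_assoc]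

lemma layeredProb_flipClass (τ : Trajectory T (Fin T × Fin W) (Fin 2)) :
    layeredProb (flipClass τ) = layeredProb τ := rfl

variable {Ω : Type*} [MeasurableSpace Ω] {μ : Measure Ω} [IsProbabilityMeasure μ]
  {Y Y' : Ω → Trajectory T (Fin T × Fin W) (Fin 2)}
  (hlaw : ∀ τ, μ.real (Y ⁻¹' {τ}) = layeredProb τ)
include hlaw

lemma ae_isLayered_of_law : ∀ᵐ ω ∂μ, IsLayered Prod.fst (Y ω) := by
  have avoids : ∀ τ : Trajectory T (Fin T × Fin W) (Fin 2), ∀ᵐ ω ∂μ,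
      ¬ IsLayered Prod.fst τ → Y ω ≠ τ := fun τ => by
    by_cases hτ : layeredProb τ = 0
    · rw [← hlaw, measureReal_eq_zero_iff] at hτ
      filter_upwards [measure_eq_zero_iff_ae_notMem.mp hτ] with ω hω _
      exact hω
    · exact ae_of_all _ fun ω hlayer => absurd (isLayered_of_layeredProb_ne_zero hτ) hlayer
  filter_upwards [ae_all_iff.mpr avoids] with ω hω
  by_contra hlayer
  exact hω _ hlayer rfl

variable (hY : Measurable Y)
include hY

lemma identDistrib_of_law (hY' : Measurable Y') (hlaw' : ∀ τ, μ.real (Y' ⁻¹' {τ}) = layeredProb τ) :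
    IdentDistrib Y' Y μ μ where
  aemeasurable_fst := hY'.aemeasurable
  aemeasurable_snd := hY.aemeasurable
  map_eq := Measure.ext_of_singleton fun τ => by
    rw [Measure.map_apply hY' (measurableSet_singleton τ),
      Measure.map_apply hY (measurableSet_singleton τ), ← measureReal_eq_measureReal_iff, hlaw,
      hlaw']

lemma measureReal_layerIndex (A : Finset (Fin T)) (g : Fin T → Fin W) :
    μ.real (Y ⁻¹' {τ | ∀ u ∈ A, layerIndex u τ = g u}) = (1 / (W : ℝ)) ^ A.card := by
  have : NeZero W := ⟨(g 0).pos.ne'⟩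
  calc μ.real (Y ⁻¹' {τ | ∀ u ∈ A, layerIndex u τ = g u})
      = ∑ τ with ∀ u ∈ A, layerIndex u τ = g u, layeredProb τ := by
        simp only [← hlaw]
        rw [sum_measureReal_preimage_singleton _ fun τ _ => hY (measurableSet_singleton τ)]
        simp
    _ = ∑ f : (Fin T → Fin W) × Fin 2,
          if ∀ u ∈ A, f.1 u = g u then (1 / (W : ℝ)) ^ T * (1 / 2) else 0 := by
        rw [Finset.sum_filter]
        refine (Fintype.sum_of_injective layeredTrajectory layeredTrajectory_injective _ _ ?_
          fun f => ?_).symm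
        · intro τ hτ
          refine ite_eq_right_iff.mpr fun _ => by_contra fun h => hτ ?_
          exact ⟨_, (isLayered_of_layeredProb_ne_zero h).eq_layeredTrajectory⟩
        · rw [layeredProb_layeredTrajectory]
          rfl
    _ = (1 / (W : ℝ)) ^ A.card := by
        rw [Fintype.sum_prod_type, ← sum_uniform_indicator A g]
        refine Finset.sum_congr rfl fun f _ => ?_
        rw [Fin.sum_univ_two]
        split_ifs <;> ring

lemma measureReal_layerIndex_eq (u : Fin T) (i : Fin W) :
    μ.real (Y ⁻¹' {τ | layerIndex u τ = i}) = 1 / W := by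
  simpa using measureReal_layerIndex hlaw hY {u} fun _ => i

lemma measureReal_layerIndex_eq_and {u v : Fin T} (huv : u ≠ v) (i j : Fin W) :
    μ.real (Y ⁻¹' {τ | layerIndex u τ = i ∧ layerIndex v τ = j}) = (1 / W) ^ 2 := by
  simpa [Finset.card_pair huv, huv.symm] using
    measureReal_layerIndex hlaw hY {u, v} fun t => if t = u then i else j

lemma identDistrib_flipClass : IdentDistrib (flipClass ∘ Y) Y μ μ := by
  refine identDistrib_of_law hlaw hY (Measurable.of_discrete.comp hY) fun τ => ?_
  rw [← layeredProb_flipClass, ← hlaw, Set.preimage_comp]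
  congr 2
  ext τ'
  exact flipClass_involutive.eq_iff

end LayeredLaw

lemma abs_sub_half_le_one {x : ℝ} (hx : x ∈ Set.Icc (0 : ℝ) 1) : |x - 1 / 2| ≤ 1 :=
  abs_le.mpr ⟨by linarith [hx.1], by linarith [hx.2]⟩

section LayeredEstimators

variable {N T W : ℕ}

lemma IsLayered.apply_eq_iff {τ : Trajectory T (Fin T × Fin W) (Fin 2)}
    (hτ : IsLayered Prod.fst τ) (s : Fin T × Fin W) : τ.1 s.1 = s ↔ layerIndex s.1 τ = s.2 :=
  ⟨fun h => congrArg Prod.snd h, fun h => Prod.ext (hτ s.1) h⟩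

variable {D : Fin N → Trajectory T (Fin T × Fin W) (Fin 2)}
  (hD : ∀ n, IsLayered Prod.fst (D n))
include hD

lemma visitCount_eq_stratumCount (s : Fin T × Fin W) :
    visitCount D s = stratumCount (layerIndex s.1) D s.2 := by
  simp only [visitCount_of_isLayered hD, (hD _).apply_eq_iff, stratumCount]

lemma directEstimate_sub_half {s : Fin T × Fin W} (hs : visitCount D s ≠ 0)
    (P : Matrix (Fin T × Fin W) (Fin 2) ℝ) (k : Fin 2) :
    directEstimate P D s k - 1 / 2 =
      (∑ n with layerIndex s.1 (D n) = s.2, centeredClass k (D n)) /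
        stratumCount (layerIndex s.1) D s.2 := by
  have hcount : (stratumCount (layerIndex s.1) D s.2 : ℝ) ≠ 0 :=
    mod_cast visitCount_eq_stratumCount hD s ▸ hs
  have sum_centeredClass : ∑ n with layerIndex s.1 (D n) = s.2, centeredClass k (D n) =
      outcomeCount D s k - stratumCount (layerIndex s.1) D s.2 * (1 / 2) := by
    rw [outcomeCount, card_filter_occurrence_of_isLayered hD s fun n _ => (D n).2 = k]
    simp only [centeredClass, (hD _).apply_eq_iff, Finset.sum_sub_distrib, Finset.sum_boole,
      Finset.filter_filter, Finset.sum_const, nsmul_eq_mul, stratumCount]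
  rw [directEstimate, if_neg hs, sum_centeredClass, visitCount_eq_stratumCount hD]
  field_simp

lemma directEstimate_sub_half_eq_stratifiedMean {s : Fin T × Fin W} (hs : visitCount D s ≠ 0)
    (P : Matrix (Fin T × Fin W) (Fin 2) ℝ) (k : Fin 2) :
    directEstimate P D s k - 1 / 2 =
      stratifiedMean (layerIndex s.1) (centeredClass k) (Pi.single s.2 1) D := by
  rw [directEstimate_sub_half hD hs, stratifiedMean, Finset.sum_eq_single s.2]
  · rw [Pi.single_eq_same, one_mul]
  · intro i _ hi
    rw [Pi.single_eq_of_ne hi, zero_mul]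
  · simp

lemma indirectEstimate_sub_half_eq_stratifiedMean (hvisit : ∀ s, visitCount D s ≠ 0)
    (P : Matrix (Fin T × Fin W) (Fin 2) ℝ) {j : ℕ} {s : Fin T × Fin W} {u : Fin T}
    (hj : s.1.val + j = u) (hu : u.val + 1 = T) (k : Fin 2) :
    indirectEstimate P D s k - 1 / 2 =
      stratifiedMean (layerIndex u) (centeredClass k) (fun i => (empiricalQ D ^ j) s (u, i)) D := by
  have hchain := isLayeredChain_empirical hD hvisit
  rw [indirectEstimate_sub hD hvisit P (j := j) (by omega), Fintype.sum_prod_type,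
    Finset.sum_eq_single u, stratifiedMean]
  · exact Finset.sum_congr rfl fun i _ => by rw [directEstimate_sub_half hD (hvisit _)]
  · refine fun t _ ht => Finset.sum_eq_zero fun i _ => ?_
    rw [hchain.pow_apply_eq_zero j fun h : t.val = s.1 + j => ht (Fin.ext (h.trans hj)), zero_mul]
  · simp

end LayeredEstimators

section LayeredSample

variable {T W : ℕ} [NeZero T] {Ω : Type*} [MeasurableSpace Ω] {μ : Measure Ω}
  [IsProbabilityMeasure μ] {X : ℕ → Ω → Trajectory T (Fin T × Fin W) (Fin 2)}

lemma isIID_of_law (hX : ∀ n, Measurable (X n)) (hindep : iIndepFun X μ)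
    (hlaw : ∀ n τ, μ.real (X n ⁻¹' {τ}) = layeredProb τ) : IsIID X μ where
  measurable := hX
  indep := hindep
  identDistrib n := identDistrib_of_law (hlaw 0) (hX 0) (hX n) (hlaw n)

variable (h : IsIID X μ) (hlaw : ∀ τ, μ.real (X 0 ⁻¹' {τ}) = layeredProb τ)
include h hlaw

lemma ae_isLayered_data : ∀ᵐ ω ∂μ, ∀ n, IsLayered Prod.fst (X n ω) :=
  ae_all_iff.mpr fun n => (h.identDistrib n).symm.ae_mem_snd (t := {τ | IsLayered Prod.fst τ})
    .of_discrete (ae_isLayered_of_law hlaw)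

lemma tendsto_mul_measureReal_exists_visitCount_eq_zero :
    Tendsto (fun N : ℕ => (N : ℝ) *
      μ.real {ω | ∃ s, visitCount (fun n : Fin N => X n ω) s = 0}) atTop (𝓝 0) := by
  refine squeeze_zero (fun N => by positivity) (fun N => ?_)
    (h.tendsto_mul_measureReal_exists_frequency_le
      (q := fun (s : Fin T × Fin W) τ => layerIndex s.1 τ = s.2)
      (fun s => measureReal_layerIndex_eq hlaw (h.measurable 0) s.1 s.2)
      fun s => one_div_pos.mpr (mod_cast s.2.pos))
  refine mul_le_mul_of_nonneg_left ?_ N.cast_nonneg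
  refine ENNReal.toReal_mono (measure_ne_top _ _) (measure_mono_ae ?_)
  filter_upwards [ae_isLayered_data h hlaw] with ω hω
  rintro ⟨s, hs⟩
  rw [visitCount_eq_stratumCount fun n : Fin N => hω n, stratumCount] at hs
  refine ⟨s, ?_⟩
  rw [hs, Nat.cast_zero]
  positivity

lemma tendsto_visitCount_div_ae : ∀ᵐ ω ∂μ, ∀ s,
    Tendsto (fun N : ℕ => (visitCount (fun n : Fin N => X n ω) s : ℝ) / N) atTop
      (𝓝 (1 / W)) := by
  refine ae_all_iff.mpr fun s => ?_
  filter_upwards [ae_isLayered_data h hlaw, h.tendsto_stratumCount_div_ae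
    (measureReal_layerIndex_eq hlaw (h.measurable 0) s.1)] with ω hω hlim
  exact (hlim s.2).congr fun N => by rw [visitCount_eq_stratumCount fun n : Fin N => hω n]

lemma tendsto_transitionCount_div_ae {s x : Fin T × Fin W} (hx : x.1.val = s.1.val + 1) :
    ∀ᵐ ω ∂μ, Tendsto (fun N : ℕ => (transitionCount (fun n : Fin N => X n ω) s x : ℝ) / N) atTop
      (𝓝 ((1 / W) ^ 2)) := by
  have hne : s.1 ≠ x.1 := fun h => by rw [h] at hx; omega
  rw [← measureReal_layerIndex_eq_and hlaw (h.measurable 0) hne s.2 x.2]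
  filter_upwards [ae_isLayered_data h hlaw, h.tendsto_frequency_ae (.of_discrete (s := {τ |
    layerIndex s.1 τ = s.2 ∧ layerIndex x.1 τ = x.2}))] with ω hω hlim
  refine hlim.congr fun N => ?_
  simp only [transitionCount_of_isLayered (fun n : Fin N => hω n) hx, (hω _).apply_eq_iff]

lemma tendsto_empiricalQ_apply_ae (s x : Fin T × Fin W) :
    ∀ᵐ ω ∂μ, Tendsto (fun N : ℕ => empiricalQ (fun n : Fin N => X n ω) s x) atTop
      (𝓝 (layeredQ T W s x)) := by
  have hW : (0 : ℝ) < 1 / W := one_div_pos.mpr (mod_cast s.2.pos)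
  have visited : ∀ᵐ ω ∂μ, ∀ᶠ N : ℕ in atTop,
      (N : ℝ) ≠ 0 ∧ visitCount (fun n : Fin N => X n ω) s ≠ 0 := by
    filter_upwards [tendsto_visitCount_div_ae h hlaw] with ω hω
    filter_upwards [(hω s).eventually (lt_mem_nhds hW)] with N hN
    constructor <;> intro h0 <;> simp [h0] at hN
  by_cases hx : x.1.val = s.1.val + 1
  · rw [layeredQ, if_pos hx]
    filter_upwards [tendsto_visitCount_div_ae h hlaw, tendsto_transitionCount_div_ae h hlaw hx,
      visited] with ω hvisit htransition hvisited
    have ratio_lim := htransition.div (hvisit s) hW.ne'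
    rw [sq, mul_div_cancel_right₀ _ hW.ne'] at ratio_lim
    refine ratio_lim.congr' (hvisited.mono fun N hN => ?_)
    simp only [empiricalQ, if_neg hN.2, Pi.div_apply]
    exact div_div_div_cancel_right₀ hN.1 _ _
  · rw [layeredQ, if_neg hx]
    filter_upwards [ae_isLayered_data h hlaw, visited] with ω hω hvisited
    exact tendsto_const_nhds.congr' (hvisited.mono fun N hN =>
      (empiricalQ_eq_zero_of_isLayered (fun n : Fin N => hω n) hN.2 hx).symm)

lemma tendsto_empiricalQ_ae :
    ∀ᵐ ω ∂μ, Tendsto (fun N : ℕ => empiricalQ (fun n : Fin N => X n ω)) atTop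
      (𝓝 (layeredQ T W)) := by
  filter_upwards [ae_all_iff.mpr fun s => ae_all_iff.mpr (tendsto_empiricalQ_apply_ae h hlaw s)]
    with ω hω
  exact tendsto_pi_nhds.mpr fun s => tendsto_pi_nhds.mpr (hω s)

lemma tendsto_mul_integral_sq_of_eq_stratifiedMean {u : Fin T} {k : Fin 2}
    {F : ∀ N, (Fin N → Trajectory T (Fin T × Fin W) (Fin 2)) → ℝ}
    {w : ∀ N, (Fin N → Trajectory T (Fin T × Fin W) (Fin 2)) → Fin W → ℝ} {w' : Fin W → ℝ}
    (hF : ∀ N D, (∀ n, IsLayered Prod.fst (D n)) → |F N D| ≤ 1)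
    (hFw : ∀ N D, (∀ n, IsLayered Prod.fst (D n)) → (∀ s, visitCount D s ≠ 0) →
      F N D = stratifiedMean (layerIndex u) (centeredClass k) (w N D) D)
    (hw : ∀ N D i, |w N D i| ≤ 1)
    (hw_flip : ∀ N j D, w N (Function.update D j (flipClass (D j))) = w N D)
    (hlim : ∀ᵐ ω ∂μ, ∀ i, Tendsto (fun N => w N (fun n => X n ω) i) atTop (𝓝 (w' i))) :
    Tendsto (fun N : ℕ => (N : ℝ) * ∫ ω, F N (fun n => X n ω) ^ 2 ∂μ) atTop
      (𝓝 (W / 4 * ∑ i, w' i ^ 2)) := by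
  have measurable_data : ∀ {N} (G : (Fin N → Trajectory T (Fin T × Fin W) (Fin 2)) → ℝ),
      Measurable fun ω => G fun n => X n ω :=
    fun G => (Measurable.of_discrete (f := G)).comp (h.measurable_data _)
  have abs_centeredClass_le : ∀ τ : Trajectory T (Fin T × Fin W) (Fin 2),
      |centeredClass k τ| ≤ 1 := fun τ => by
    rw [← sq_le_one_iff_abs_le_one, centeredClass_sq]
    norm_num
  refine tendsto_mul_integral_sq_congr (C := max 1 W)
    (V := fun N ω => stratifiedMean (layerIndex u) (centeredClass k) (w N fun n => X n ω)
      fun n : Fin N => X n ω)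
    (fun N => measurable_data (F N)) (fun N => measurable_data fun D =>
      stratifiedMean (layerIndex u) (centeredClass k) (w N D) D) (fun N => ?_)
    (fun N => ae_of_all _ fun ω => ?_) ?_ ?_
  · filter_upwards [ae_isLayered_data h hlaw] with ω hω
    exact (hF N _ fun n => hω n).trans (le_max_left _ _)
  · refine le_max_of_le_right ?_
    simpa using abs_stratifiedMean_le zero_le_one abs_centeredClass_le (hw N _)
  · refine squeeze_zero (fun N => by positivity) (fun N => ?_)
      (tendsto_mul_measureReal_exists_visitCount_eq_zero h hlaw)
    refine mul_le_mul_of_nonneg_left ?_ N.cast_nonneg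
    refine ENNReal.toReal_mono (measure_ne_top _ _) (measure_mono_ae ?_)
    filter_upwards [ae_isLayered_data h hlaw] with ω hω hne
    by_contra! hvisit
    exact hne (hFw N _ (fun n => hω n) fun s hs => hvisit ⟨s, hs⟩)
  · have limit_eq : 1 / 4 * ∑ i, w' i ^ 2 / (1 / (W : ℝ)) = W / 4 * ∑ i, w' i ^ 2 := by
      rw [← Finset.sum_div]
      field_simp
    rw [← limit_eq]
    exact h.tendsto_mul_integral_stratifiedMean_sq
      (measureReal_layerIndex_eq hlaw (h.measurable 0) u)
      (fun i => one_div_pos.mpr (mod_cast i.pos)) (identDistrib_flipClass hlaw (h.measurable 0))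
      (fun _ => rfl) (centeredClass_flipClass k) (centeredClass_sq k) hw hw_flip hlim

lemma tendsto_mul_integral_directEstimate_sub_half_sq {P : Matrix (Fin T × Fin W) (Fin 2) ℝ}
    (hP : IsRowStochastic P) (s : Fin T × Fin W) (k : Fin 2) :
    Tendsto (fun N : ℕ => (N : ℝ) *
      ∫ ω, (directEstimate P (fun n : Fin N => X n ω) s k - 1 / 2) ^ 2 ∂μ) atTop
      (𝓝 (W / 4)) := by
  have limit_eq : (W : ℝ) / 4 * ∑ i, (Pi.single s.2 1 : Fin W → ℝ) i ^ 2 = W / 4 := by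
    simp [Pi.single_apply]
  rw [← limit_eq]
  exact tendsto_mul_integral_sq_of_eq_stratifiedMean h hlaw
    (F := fun N D => directEstimate P D s k - 1 / 2) (w := fun _ _ => Pi.single s.2 1)
    (fun N D _ => abs_sub_half_le_one (directEstimate_mem_Icc D s k (hP.mem_Icc s k)))
    (fun N D hD hvisit => directEstimate_sub_half_eq_stratifiedMean hD (hvisit s) P k)
    (fun _ _ i => by rw [Pi.single_apply]; split_ifs <;> simp)
    (fun _ _ _ => rfl) (ae_of_all _ fun _ _ => tendsto_const_nhds)

lemma tendsto_mul_integral_indirectEstimate_sub_half_sq (hTW : T = 1 → W = 1)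
    {P : Matrix (Fin T × Fin W) (Fin 2) ℝ} (hP : IsRowStochastic P) (m : Fin W) (k : Fin 2) :
    Tendsto (fun N : ℕ => (N : ℝ) *
      ∫ ω, (indirectEstimate P (fun n : Fin N => X n ω) (0, m) k - 1 / 2) ^ 2 ∂μ) atTop
      (𝓝 (1 / 4)) := by
  obtain ⟨u, hu⟩ : ∃ u : Fin T, u.val + 1 = T :=
    ⟨⟨T - 1, by have := NeZero.pos T; omega⟩, Nat.sub_add_cancel (NeZero.pos T)⟩
  have limit_eq : (W : ℝ) / 4 * ∑ _i : Fin W, (1 / (W : ℝ)) ^ 2 = 1 / 4 := by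
    have hW : (W : ℝ) ≠ 0 := mod_cast m.pos.ne'
    rw [Finset.sum_const, Finset.card_univ, Fintype.card_fin, nsmul_eq_mul]
    field_simp
  rw [← limit_eq]
  refine tendsto_mul_integral_sq_of_eq_stratifiedMean h hlaw (u := u) (k := k)
    (F := fun N D => indirectEstimate P D (0, m) k - 1 / 2)
    (w := fun N D i => (empiricalQ D ^ u.val) (0, m) (u, i))
    (fun N D hD => abs_sub_half_le_one
      (indirectEstimate_mem_Icc hD (fun s => hP.mem_Icc s k) (0, m)))
    (fun N D hD hvisit => indirectEstimate_sub_half_eq_stratifiedMean hD hvisit P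
      (by simp) hu k)
    (fun N D i => ?_) (fun N j D => ?_) ?_
  · have hmem := empiricalQ_pow_apply_mem_Icc D u.val (0, m) (u, i)
    exact abs_le.mpr ⟨by linarith [hmem.1], hmem.2⟩
  · rw [empiricalQ_congr (apply_update_of_invariant (g := flipClass) (c := Prod.fst)
      (fun _ => rfl) j · D)]
  · filter_upwards [tendsto_empiricalQ_ae h hlaw] with ω hω i
    rw [← layeredQ_pow_apply_last hTW hu m i]
    exact tendsto_pi_nhds.mp (tendsto_pi_nhds.mp (hω.pow u.val) (0, m)) (u, i)

end LayeredSample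

theorem proposition3 (T W : ℕ) [NeZero T] (hTW : T = 1 → W = 1)
    {Ω : Type*} [MeasurableSpace Ω] (μ : Measure Ω) [IsProbabilityMeasure μ]
    (X : ℕ → Ω → Trajectory T (Fin T × Fin W) (Fin 2))
    (hX_meas : ∀ n, Measurable (X n))
    (hX_indep : iIndepFun X μ)
    (hX_law : ∀ n τ, μ.real (X n ⁻¹' {τ}) =
      trajectoryProb (layeredInit T W) (layeredQ T W) (layeredR T W) τ)
    (Pdir Pind : Matrix (Fin T × Fin W) (Fin 2) ℝ)
    (hPdir : IsRowStochastic Pdir) (hPind : IsRowStochastic Pind)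
    (m : Fin W) (k : Fin 2) :
    Tendsto
      (fun N : ℕ =>
        (∫ ω, (indirectEstimate Pind (fun n : Fin N => X n ω) (0, m) k
            - absorptionProb (layeredQ T W) (layeredR T W) (0, m) k) ^ 2 ∂μ) /
        (∫ ω, (directEstimate Pdir (fun n : Fin N => X n ω) (0, m) k
            - absorptionProb (layeredQ T W) (layeredR T W) (0, m) k) ^ 2 ∂μ))
      atTop (𝓝 (1 / (W : ℝ))) := by
  have h := isIID_of_law hX_meas hX_indep hX_law
  have direct_lim := tendsto_mul_integral_directEstimate_sub_half_sq h (hX_law 0) hPdir (0, m) k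
  have indirect_lim :=
    tendsto_mul_integral_indirectEstimate_sub_half_sq h (hX_law 0) hTW hPind m k
  have hW : (W : ℝ) ≠ 0 := mod_cast m.pos.ne'
  have limit_eq : (1 / 4 : ℝ) / (W / 4) = 1 / W := by field_simp
  rw [absorptionProb_layered, ← limit_eq]
  refine (indirect_lim.div direct_lim (by positivity)).congr' ?_
  filter_upwards [eventually_ne_atTop 0] with N hN
  exact mul_div_mul_left _ _ (mod_cast hN)
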